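/- Let $k \ge 0$ be an integer. For finite sets $A,B \subseteq \mathbb{R}^k$ and $\lambda \ge 0$ write $A+B=\{a+b : a\in A,\ b\in B\}$ and $\lambda A=\{\lambda a : a\in A\}$. For nonempty finite $A \subseteq \mathbb{R}^k$ let $h_A(x)=\sup\{a\cdot x : a\in A\}$ be its support function. Let $\delta$ be a real-valued function defined on the finite subsets of $\mathbb{R}^k$. We say that - $\delta$ is a semidiversity if $\delta(A)\ge 0$ for all finite $A$, $\delta(A)=0$ whenever $|A|\le 1$, and $\delta(A\cup C)\le \delta(A\cup B)+\delta(B\cup C)$ for all finite $A,B,C$ with $B\neq\emptyset$; - $\delta$ is Minkowski linear if $\delta(\lambda A)=\lambda\,\delta(A)$ and $\delta(A+B)=\delta(A)+\delta(B)$ for all $\lambda\ge 0$ and all nonempty finite $A,B$. Theorem. The function $\delta$ is a Minkowski linear semidiversity if and only if there is a positive finite Borel measure $\nu$ (possibly zero) on the unit sphere $\mathbb{S}^{k-1}=\{x\in\mathbb{R}^k : \|x\|_2=1\}$ such that $$\int_{\mathbb{S}^{k-1}} x \,\mathrm{d}\nu(x)=0, \qquad \delta(\emptyset)=0, \qquad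 \delta(A)=\int_{\mathbb{S}^{k-1}} h_A(x)\,\mathrm{d}\nu(x)\ \text{ for all nonempty finite } A\subseteq\mathbb{R}^k .$$ Moreover, such a measure $\nu$ is unique. -/

import Mathlib

open scoped Pointwise

open scoped Classical in
/-- A semidiversity on `X`: a function on the finite subsets of `X` which is non-negative,
vanishes on sets with at most one element (so also on the empty set), and satisfies the
triangle inequality. -/
structure IsSemidiversity {X : Type*} (δ : Finset X → ℝ) : Prop where
  nonneg : ∀ A : Finset X, 0 ≤ δ A
  eq_zero : ∀ A : Finset X, A.card ≤ 1 → δ A = 0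
  triangle : ∀ A B C : Finset X, B.Nonempty → δ (A ∪ C) ≤ δ (A ∪ B) + δ (B ∪ C)

open scoped Classical in
/-- Minkowski linearity of a function on the finite subsets of a real vector space.
Here `r • A = {r • a | a ∈ A}`, and `A + B` is the Minkowski sum. -/
structure IsMinkowskiLinear {E : Type*} [AddCommGroup E] [Module ℝ E]
    (δ : Finset E → ℝ) : Prop where
  smul : ∀ (r : ℝ) (A : Finset E), 0 ≤ r → A.Nonempty → δ (r • A) = r * δ A
  add : ∀ A B : Finset E, A.Nonempty → B.Nonempty → δ (A + B) = δ A + δ B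

/-- The support function `h_A(x) = sup {a · x | a ∈ A}` of a (nonempty bounded) set `A`. -/
noncomputable def supportFn {k : ℕ} (A : Set (EuclideanSpace ℝ (Fin k)))
    (x : EuclideanSpace ℝ (Fin k)) : ℝ :=
  sSup ((fun a => inner ℝ a x) '' A)

/-- `ν` is a (positive) finite Borel measure on the Euclidean unit sphere of `ℝ^k`, with centroid
zero, such that `δ(A) = ∫ h_A dν` for all nonempty finite `A`; the empty set gets the value `0`. -/
structure IsRepresentingMeasure {k : ℕ} (δ : Finset (EuclideanSpace ℝ (Fin k)) → ℝ)
    (ν : MeasureTheory.Measure (Metric.sphere (0 : EuclideanSpace ℝ (Fin k)) 1)) : Prop where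
  finite : MeasureTheory.IsFiniteMeasure ν
  centroid : ∫ x, (x : EuclideanSpace ℝ (Fin k)) ∂ν = 0
  empty : δ ∅ = 0
  eq_integral : ∀ A : Finset (EuclideanSpace ℝ (Fin k)), A.Nonempty →
    δ A = ∫ x, supportFn (A : Set (EuclideanSpace ℝ (Fin k))) (x : EuclideanSpace ℝ (Fin k)) ∂ν

/-! ### Monotonicity of a Minkowski linear semidiversity under inclusion of convex hulls. -/

section Semidiversity

/-! The plan is to turn `δ` into a positive linear functional on the continuous functions on the
sphere and apply Riesz–Markov–Kakutani. The crux is that `δ` is monotone under inclusion of convex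
hulls (`IsMinkowskiLinear.le_of_subset_convexHull`). Additivity allows cancellation of a Minkowski
summand, which handles rational points of a segment; the triangle inequality passes to real points.

By Hahn–Banach, `h_B ≤ h_A` on the sphere puts `B` in the hull of `A`, so `δ B ≤ δ A`. Hence `h_A ↦
δ A` is well defined and positive on the span of support functions (`combination_nonneg`). It
extends positively by `riesz_extension`, because some support function is strictly positive on the
sphere. The centroid vanishes because `δ` vanishes on singletons.

The converse integrates pointwise facts about support functions. For uniqueness, the span is a
lattice that interpolates values at any two points, so it is uniformly dense. -/

open scoped Classical in
/-- A semidiversity is unchanged or increased when a point is added. -/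
theorem IsSemidiversity.le_insert {X : Type*} {δ : Finset X → ℝ} (h : IsSemidiversity δ)
    (x : X) (A : Finset X) : δ A ≤ δ (insert x A) := by
  -- With `C = ∅` the last term is the value on a singleton, which is zero.
  have h1 := h.triangle A {x} ∅ (Finset.singleton_nonempty x)
  have h2 := h.eq_zero ({x} ∪ ∅) (by simp)
  rw [h2, Finset.union_empty, add_zero, Finset.union_comm] at h1
  exact h1

theorem IsSemidiversity.mono {X : Type*} {δ : Finset X → ℝ} (h : IsSemidiversity δ) :
    Monotone δ := by
  classical
  intro A B hAB
  have key : ∀ C : Finset X, δ A ≤ δ (C ∪ A) := by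
    intro C
    induction C using Finset.induction_on with
    | empty => simp
    | insert a s _ ih =>
      rw [Finset.insert_union]
      convert ih.trans (h.le_insert a (s ∪ A))
  have := key B
  rwa [Finset.union_eq_left.2 hAB] at this

open scoped Classical in
theorem IsSemidiversity.insert_le_insert_add {X : Type*} {δ : Finset X → ℝ}
    (h : IsSemidiversity δ) (x y : X) (A : Finset X) :
    δ (insert x A) ≤ δ (insert y A) + δ {y, x} := by
  have h1 := h.triangle A {y} {x} (Finset.singleton_nonempty y)
  have e1 : A ∪ {x} = insert x A := by ext; simp
  have e2 : A ∪ {y} = insert y A := by ext; simp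
  rwa [e1, e2, ← Finset.insert_eq] at h1

variable {E : Type*} [AddCommGroup E] [Module ℝ E] {δ : Finset E → ℝ}

open scoped Classical in
/-- On a two-point set, the value depends on the difference vector, homogeneously. -/
theorem IsMinkowskiLinear.pair_add_smul (h : IsSemidiversity δ) (hl : IsMinkowskiLinear δ)
    (u w : E) {r : ℝ} (hr : 0 ≤ r) : δ {u, u + r • w} = r * δ {0, w} := by
  have e : ({u, u + r • w} : Finset E) = {u} + r • ({0, w} : Finset E) := by
    ext v
    simp [Finset.singleton_add, Finset.smul_finset_insert, Finset.mem_vadd_finset, eq_comm]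
  rw [e, hl.add _ _ (by simp) ((Finset.insert_nonempty _ _).smul_finset),
    hl.smul _ _ hr (by simp), h.eq_zero {u} (by simp), zero_add]

open scoped Classical in
/-- Adding a rational convex combination of two points of `C` does not increase the value. -/
theorem IsMinkowskiLinear.insert_div_le (h : IsSemidiversity δ) (hl : IsMinkowskiLinear δ)
    {C : Finset E} {x w : E} (hx : x ∈ C) (hy : x + w ∈ C) {p n : ℕ} (hn : 0 < n) (hp : p ≤ n) :
    δ (insert (x + ((p : ℝ) / n) • w) C) ≤ δ C := by
  have hn' : (n : ℝ) ≠ 0 := by positivity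
  -- `S` is an arithmetic progression of step `w / n` that stops short of `w`. Shifting `x + S` by
  -- `(p / n) • w` either stays in `x + S` or wraps around into `(x + w) + S`, so the new point adds
  -- nothing to `S + C`, and `δ S` cancels.
  set S : Finset E := (Finset.range n).image fun j : ℕ => ((j : ℝ) / n) • w with hS
  have hSne : S.Nonempty := ⟨_, Finset.mem_image_of_mem _ (Finset.mem_range.2 hn)⟩
  have hsub : S + insert (x + ((p : ℝ) / n) • w) C ⊆ S + C := by
    intro v hv
    obtain ⟨s, hs, c, hc, rfl⟩ := Finset.mem_add.1 hv
    rcases Finset.mem_insert.1 hc with rfl | hc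
    · obtain ⟨j, hj, rfl⟩ := Finset.mem_image.1 hs
      have hj := Finset.mem_range.1 hj
      rcases lt_or_ge (j + p) n with hlt | hge
      · refine Finset.mem_add.2 ⟨_, Finset.mem_image_of_mem _ (Finset.mem_range.2 hlt), x, hx, ?_⟩
        push_cast
        rw [add_div]
        module
      · obtain ⟨m, hm⟩ := Nat.exists_eq_add_of_le hge
        refine Finset.mem_add.2 ⟨_, Finset.mem_image_of_mem _
          (Finset.mem_range.2 (show m < n by omega)), x + w, hy, ?_⟩
        have hm' : (m : ℝ) / n = j / n + p / n - 1 := by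
          have : (j : ℝ) + p = n + m := by exact_mod_cast hm
          field_simp
          linarith
        rw [hm']
        module
    · exact Finset.add_mem_add hs hc
  have h1 := h.mono hsub
  rw [hl.add _ _ hSne (Finset.insert_nonempty _ _), hl.add _ _ hSne ⟨x, hx⟩] at h1
  linarith

open scoped Classical in
/-- Adding a point of a segment between two points of `C` does not increase the value. -/
theorem IsMinkowskiLinear.insert_segment_le (h : IsSemidiversity δ) (hl : IsMinkowskiLinear δ)
    {C : Finset E} {x w : E} (hx : x ∈ C) (hy : x + w ∈ C) {t : ℝ} (ht0 : 0 ≤ t) (ht1 : t ≤ 1) :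
    δ (insert (x + t • w) C) ≤ δ C := by
  -- Replacing `t` by `⌊t * n⌋₊ / n` moves the point by at most `w / n`; the triangle inequality and
  -- homogeneity on pairs bound the cost.
  have key : ∀ n : ℕ, 0 < n → δ (insert (x + t • w) C) ≤ δ C + 1 / n * δ {0, w} := by
    intro n hn
    have hn' : (0 : ℝ) < n := by exact_mod_cast hn
    set p := ⌊t * n⌋₊
    have hp1 : (p : ℝ) ≤ t * n := Nat.floor_le (by positivity)
    have hp2 : t * n < p + 1 := Nat.lt_floor_add_one _
    have hpn : p ≤ n := by
      have : (p : ℝ) ≤ n := hp1.trans (by nlinarith)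
      exact_mod_cast this
    have hr : 0 ≤ t - p / n := by rw [sub_nonneg, div_le_iff₀ hn']; exact hp1
    have hr' : t - p / n ≤ 1 / n := by
      rw [sub_le_iff_le_add, ← add_div, le_div_iff₀ hn']; linarith
    have h1 := h.insert_le_insert_add (x + t • w) (x + ((p : ℝ) / n) • w) C
    have h2 := hl.insert_div_le h hx hy hn hpn
    have h3 := hl.pair_add_smul h (x + ((p : ℝ) / n) • w) w hr
    have e : x + ((p : ℝ) / n) • w + (t - p / n) • w = x + t • w := by module
    rw [e] at h3
    have := mul_le_mul_of_nonneg_right hr' (h.nonneg {0, w})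
    linarith
  have hlim : Filter.Tendsto (fun n : ℕ => δ C + 1 / (n : ℝ) * δ {0, w}) Filter.atTop
      (nhds (δ C + 0 * δ {0, w})) :=
    (tendsto_one_div_atTop_nhds_zero_nat.mul_const _).const_add _
  have := ge_of_tendsto hlim ((Filter.eventually_gt_atTop 0).mono key)
  linarith

open scoped Classical in
/-- Adding a point of the convex hull does not increase the value. -/
theorem IsMinkowskiLinear.insert_le_of_mem_convexHull (h : IsSemidiversity δ)
    (hl : IsMinkowskiLinear δ) {A C : Finset E} (hAC : A ⊆ C) {x : E}
    (hx : x ∈ convexHull ℝ (A : Set E)) : δ (insert x C) ≤ δ C := by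
  -- Quantifying over every `C ⊇ A` makes `T` convex: the endpoints of a segment can first be
  -- adjoined to `C`.
  let T : Set E := {x | ∀ C : Finset E, A ⊆ C → δ (insert x C) ≤ δ C}
  have hT : Convex ℝ T := by
    intro y hy z hz a b ha hb hab C hC
    have h1 : δ (insert (a • y + b • z) C) ≤ δ (insert (a • y + b • z) (insert z (insert y C))) :=
      h.mono (Finset.insert_subset_insert _ (by intro v hv; simp [hv]))
    have e : a • y + b • z = y + b • (z - y) := by
      obtain rfl : a = 1 - b := by linarith
      module
    have h2 : δ (insert (a • y + b • z) (insert z (insert y C))) ≤ δ (insert z (insert y C)) := by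
      rw [e]
      exact hl.insert_segment_le h (by simp) (by simp) hb (by linarith)
    have h3 := hz (insert y C) (hC.trans (Finset.subset_insert _ _))
    have h4 := hy C hC
    linarith
  have hAT : (A : Set E) ⊆ T := by
    intro y hy C hC
    rw [Finset.insert_eq_self.2 (hC hy)]
  exact convexHull_min hAT hT hx C hAC

theorem IsMinkowskiLinear.le_of_subset_convexHull (h : IsSemidiversity δ)
    (hl : IsMinkowskiLinear δ) {A B : Finset E} (hBA : (B : Set E) ⊆ convexHull ℝ (A : Set E)) :
    δ B ≤ δ A := by
  classical
  have key : ∀ B : Finset E, (B : Set E) ⊆ convexHull ℝ (A : Set E) → δ (B ∪ A) ≤ δ A := by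
    intro B
    induction B using Finset.induction_on with
    | empty => simp
    | insert b s _ ih =>
      intro hs
      rw [Finset.coe_insert, Set.insert_subset_iff] at hs
      rw [Finset.insert_union]
      refine le_trans ?_ (ih hs.2)
      convert hl.insert_le_of_mem_convexHull h (C := s ∪ A) Finset.subset_union_right hs.1
  exact (h.mono Finset.subset_union_left).trans (key B hBA)

end Semidiversity

/-! ### Support functions and their linear span. -/

section SupportFunction

variable {k : ℕ}

theorem supportFn_le_iff {A : Finset (EuclideanSpace ℝ (Fin k))} (hA : A.Nonempty)
    {x : EuclideanSpace ℝ (Fin k)} {c : ℝ} :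
    supportFn (A : Set _) x ≤ c ↔ ∀ a ∈ A, inner ℝ a x ≤ c := by
  rw [supportFn, ← Finset.sup'_eq_csSup_image A hA, Finset.sup'_le_iff]

theorem inner_le_supportFn {A : Finset (EuclideanSpace ℝ (Fin k))}
    {a : EuclideanSpace ℝ (Fin k)} (ha : a ∈ A) (x : EuclideanSpace ℝ (Fin k)) :
    inner ℝ a x ≤ supportFn (A : Set _) x :=
  (supportFn_le_iff ⟨a, ha⟩).1 le_rfl a ha

theorem exists_inner_eq_supportFn {A : Finset (EuclideanSpace ℝ (Fin k))} (hA : A.Nonempty)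
    (x : EuclideanSpace ℝ (Fin k)) : ∃ a ∈ A, supportFn (A : Set _) x = inner ℝ a x := by
  rw [supportFn, ← Finset.sup'_eq_csSup_image A hA]
  exact Finset.exists_mem_eq_sup' hA _

theorem continuous_supportFn {A : Finset (EuclideanSpace ℝ (Fin k))} (hA : A.Nonempty) :
    Continuous (supportFn (A : Set (EuclideanSpace ℝ (Fin k)))) := by
  have : supportFn (A : Set (EuclideanSpace ℝ (Fin k)))
      = fun x => A.sup' hA fun a => inner ℝ a x := by
    ext x
    rw [supportFn, ← Finset.sup'_eq_csSup_image A hA]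
  rw [this]
  exact Continuous.finset_sup'_apply hA fun a _ => continuous_const.inner continuous_id

theorem supportFn_singleton (a x : EuclideanSpace ℝ (Fin k)) :
    supportFn (({a} : Finset (EuclideanSpace ℝ (Fin k))) : Set _) x = inner ℝ a x := by
  simp [supportFn]

theorem supportFn_add [DecidableEq (EuclideanSpace ℝ (Fin k))]
    {A B : Finset (EuclideanSpace ℝ (Fin k))} (hA : A.Nonempty) (hB : B.Nonempty)
    (x : EuclideanSpace ℝ (Fin k)) :
    supportFn ((A + B : Finset _) : Set (EuclideanSpace ℝ (Fin k))) x
      = supportFn (A : Set _) x + supportFn (B : Set _) x := by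
  refine le_antisymm ((supportFn_le_iff (hA.add hB)).2 fun c hc => ?_) ?_
  · obtain ⟨a, ha, b, hb, rfl⟩ := Finset.mem_add.1 hc
    rw [inner_add_left]
    exact add_le_add (inner_le_supportFn ha x) (inner_le_supportFn hb x)
  · obtain ⟨a, ha, ea⟩ := exists_inner_eq_supportFn hA x
    obtain ⟨b, hb, eb⟩ := exists_inner_eq_supportFn hB x
    rw [ea, eb, ← inner_add_left]
    exact inner_le_supportFn (Finset.add_mem_add ha hb) x

theorem supportFn_smul [DecidableEq (EuclideanSpace ℝ (Fin k))]
    {A : Finset (EuclideanSpace ℝ (Fin k))} (hA : A.Nonempty) {r : ℝ} (hr : 0 ≤ r)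
    (x : EuclideanSpace ℝ (Fin k)) :
    supportFn ((r • A : Finset _) : Set (EuclideanSpace ℝ (Fin k))) x
      = r * supportFn (A : Set _) x := by
  refine le_antisymm ((supportFn_le_iff hA.smul_finset).2 fun c hc => ?_) ?_
  · obtain ⟨a, ha, rfl⟩ := Finset.mem_smul_finset.1 hc
    rw [real_inner_smul_left]
    exact mul_le_mul_of_nonneg_left (inner_le_supportFn ha x) hr
  · obtain ⟨a, ha, ea⟩ := exists_inner_eq_supportFn hA x
    rw [ea, ← real_inner_smul_left]
    exact inner_le_supportFn (Finset.smul_mem_smul_finset ha) x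

theorem supportFn_union [DecidableEq (EuclideanSpace ℝ (Fin k))]
    {A B : Finset (EuclideanSpace ℝ (Fin k))} (hA : A.Nonempty) (hB : B.Nonempty)
    (x : EuclideanSpace ℝ (Fin k)) :
    supportFn ((A ∪ B : Finset _) : Set (EuclideanSpace ℝ (Fin k))) x
      = max (supportFn (A : Set _) x) (supportFn (B : Set _) x) := by
  refine eq_of_forall_ge_iff fun c => ?_
  rw [max_le_iff, supportFn_le_iff (hA.mono Finset.subset_union_left), supportFn_le_iff hA,
    supportFn_le_iff hB]
  simp only [Finset.mem_union, or_imp, forall_and]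

/-- If the support functions compare on the sphere, then the convex hulls compare. -/
theorem subset_convexHull_of_supportFn_le {A B : Finset (EuclideanSpace ℝ (Fin k))}
    (hA : A.Nonempty)
    (h : ∀ x : Metric.sphere (0 : EuclideanSpace ℝ (Fin k)) 1,
      supportFn (B : Set _) (x : EuclideanSpace ℝ (Fin k)) ≤ supportFn (A : Set _) (x : EuclideanSpace ℝ (Fin k))) :
    (B : Set (EuclideanSpace ℝ (Fin k))) ⊆ convexHull ℝ (A : Set (EuclideanSpace ℝ (Fin k))) := by
  intro b hb
  by_contra hcon
  obtain ⟨f, u, hf, hu⟩ := geometric_hahn_banach_closed_point (convex_convexHull ℝ _)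
    (A.finite_toSet.isClosed_convexHull ℝ) hcon
  obtain ⟨v, rfl⟩ := (InnerProductSpace.toDual ℝ (EuclideanSpace ℝ (Fin k))).surjective f
  simp only [InnerProductSpace.toDual_apply_apply] at hf hu
  obtain ⟨a₀, ha₀⟩ := hA
  have hv : v ≠ 0 := by
    rintro rfl
    have := hf a₀ (subset_convexHull ℝ _ ha₀)
    simp only [inner_zero_left] at this hu
    linarith
  have hv' : 0 < ‖v‖ := norm_pos_iff.2 hv
  -- The separating direction, normalised so that the hypothesis on the sphere applies.
  let y : Metric.sphere (0 : EuclideanSpace ℝ (Fin k)) 1 :=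
    ⟨‖v‖⁻¹ • v, by simp [norm_smul, hv'.ne']⟩
  obtain ⟨a, ha, ea⟩ := exists_inner_eq_supportFn ⟨a₀, ha₀⟩ (y : EuclideanSpace ℝ (Fin k))
  have h1 := (inner_le_supportFn hb (y : EuclideanSpace ℝ (Fin k))).trans (h y)
  rw [ea] at h1
  simp only [y, real_inner_smul_right] at h1
  have h2 := le_of_mul_le_mul_left h1 (inv_pos.2 hv')
  have h3 := hf a (subset_convexHull ℝ _ ha)
  rw [real_inner_comm, real_inner_comm v a] at h2
  linarith

/-- The support function of a nonempty finite set, as a continuous function on the sphere. -/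
noncomputable def sphereSupport (A : {A : Finset (EuclideanSpace ℝ (Fin k)) // A.Nonempty}) :
    C(Metric.sphere (0 : EuclideanSpace ℝ (Fin k)) 1, ℝ) where
  toFun x := supportFn (A.1 : Set _) (x : EuclideanSpace ℝ (Fin k))
  continuous_toFun := (continuous_supportFn A.2).comp continuous_subtype_val

/-- Linear extension of `sphereSupport` to formal combinations of nonempty finite sets. -/
noncomputable def supportCombination (k : ℕ) :
    ({A : Finset (EuclideanSpace ℝ (Fin k)) // A.Nonempty} →₀ ℝ) →ₗ[ℝ]
      C(Metric.sphere (0 : EuclideanSpace ℝ (Fin k)) 1, ℝ) :=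
  Finsupp.linearCombination ℝ sphereSupport

theorem sphereSupport_add [DecidableEq (EuclideanSpace ℝ (Fin k))]
    (A B : {A : Finset (EuclideanSpace ℝ (Fin k)) // A.Nonempty}) :
    sphereSupport ⟨A.1 + B.1, A.2.add B.2⟩ = sphereSupport A + sphereSupport B :=
  ContinuousMap.ext fun x => supportFn_add A.2 B.2 x

theorem sphereSupport_smul [DecidableEq (EuclideanSpace ℝ (Fin k))] {r : ℝ} (hr : 0 ≤ r)
    (A : {A : Finset (EuclideanSpace ℝ (Fin k)) // A.Nonempty}) :
    sphereSupport ⟨r • A.1, A.2.smul_finset⟩ = r • sphereSupport A :=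
  ContinuousMap.ext fun x => supportFn_smul A.2 hr x

theorem sphereSupport_union [DecidableEq (EuclideanSpace ℝ (Fin k))]
    (A B : {A : Finset (EuclideanSpace ℝ (Fin k)) // A.Nonempty}) :
    sphereSupport ⟨A.1 ∪ B.1, A.2.mono Finset.subset_union_left⟩
      = sphereSupport A ⊔ sphereSupport B :=
  ContinuousMap.ext fun x => supportFn_union A.2 B.2 x

/-- Every formal combination has the same support function and the same value, under any
Minkowski linear `δ`, as a difference of two sets. -/
theorem exists_sub_of_combination {δ : Finset (EuclideanSpace ℝ (Fin k)) → ℝ}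
    (hl : IsMinkowskiLinear δ)
    (f : {A : Finset (EuclideanSpace ℝ (Fin k)) // A.Nonempty} →₀ ℝ) :
    ∃ A B : {A : Finset (EuclideanSpace ℝ (Fin k)) // A.Nonempty},
      supportCombination k f = sphereSupport A - sphereSupport B ∧
      Finsupp.linearCombination ℝ (fun A : {A : Finset (EuclideanSpace ℝ (Fin k)) // A.Nonempty} =>
        δ A.1) f = δ A.1 - δ B.1 := by
  classical
  induction f using Finsupp.induction_linear with
  | zero => exact ⟨⟨{0}, by simp⟩, ⟨{0}, by simp⟩, by simp, by simp⟩
  | add f g hf hg =>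
    obtain ⟨A, B, h1, h2⟩ := hf
    obtain ⟨C, D, h3, h4⟩ := hg
    refine ⟨⟨A.1 + C.1, A.2.add C.2⟩, ⟨B.1 + D.1, B.2.add D.2⟩, ?_, ?_⟩
    · rw [map_add, h1, h3, sphereSupport_add, sphereSupport_add]
      abel
    · have e1 : δ (A.1 + C.1) = δ A.1 + δ C.1 := by convert hl.add _ _ A.2 C.2
      have e2 : δ (B.1 + D.1) = δ B.1 + δ D.1 := by convert hl.add _ _ B.2 D.2
      rw [map_add, h2, h4, e1, e2]
      ring
  | single A r =>
    have hz : ∀ (s : ℝ), 0 ≤ s → δ (s • A.1) = s * δ A.1 := fun s hs => by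
      convert hl.smul s _ hs A.2
      rfl
    -- Homogeneity holds only for nonnegative scalars, so a coefficient is split into positive and
    -- negative parts.
    have hneg : ∀ r : ℝ, r = max r 0 - max (-r) 0 := fun r => by
      rcases le_total r 0 with h | h <;> simp [h]
    refine ⟨⟨max r 0 • A.1, A.2.smul_finset⟩, ⟨max (-r) 0 • A.1, A.2.smul_finset⟩, ?_, ?_⟩
    · rw [sphereSupport_smul (le_max_right _ _), sphereSupport_smul (le_max_right _ _), ← sub_smul,
        ← hneg, supportCombination, Finsupp.linearCombination_single]
    · rw [hz _ (le_max_right _ _), hz _ (le_max_right _ _), ← sub_mul, ← hneg,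
        Finsupp.linearCombination_single, smul_eq_mul]

/-- Once the combination is reduced to a difference of two sets, this is hull monotonicity. Applied
to `f` and `-f`, it also shows that the value depends only on the resulting function. -/
theorem combination_nonneg {δ : Finset (EuclideanSpace ℝ (Fin k)) → ℝ}
    (h : IsSemidiversity δ) (hl : IsMinkowskiLinear δ)
    {f : {A : Finset (EuclideanSpace ℝ (Fin k)) // A.Nonempty} →₀ ℝ}
    (hf : 0 ≤ supportCombination k f) :
    0 ≤ Finsupp.linearCombination ℝ
      (fun A : {A : Finset (EuclideanSpace ℝ (Fin k)) // A.Nonempty} => δ A.1) f := by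
  obtain ⟨A, B, h1, h2⟩ := exists_sub_of_combination hl f
  rw [h2, sub_nonneg]
  rw [h1, sub_nonneg] at hf
  exact hl.le_of_subset_convexHull h (subset_convexHull_of_supportFn_le A.2 fun x => hf x)

/-- Some nonempty finite set has a support function that is positive on the whole sphere. -/
theorem exists_sphereSupport_pos (k : ℕ) :
    ∃ A : {A : Finset (EuclideanSpace ℝ (Fin k)) // A.Nonempty}, ∀ x, 0 < sphereSupport A x := by
  classical
  let e : Fin k → EuclideanSpace ℝ (Fin k) := fun i => EuclideanSpace.single i 1
  let A : Finset (EuclideanSpace ℝ (Fin k)) :=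
    -- The vectors `±e i` give positivity; `0` keeps the set nonempty when `k = 0`.
    insert 0 (Finset.univ.image e ∪ Finset.univ.image fun i => -e i)
  refine ⟨⟨A, Finset.insert_nonempty _ _⟩, fun x => ?_⟩
  have hx : (x : EuclideanSpace ℝ (Fin k)) ≠ 0 := ne_zero_of_mem_unit_sphere x
  obtain ⟨i, hi⟩ : ∃ i, (x : EuclideanSpace ℝ (Fin k)) i ≠ 0 := by
    by_contra! hcon
    exact hx (by ext i; simpa using hcon i)
  have h1 : inner ℝ (e i) (x : EuclideanSpace ℝ (Fin k)) = (x : EuclideanSpace ℝ (Fin k)) i := by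
    simp [e, EuclideanSpace.inner_single_left]
  rcases lt_or_gt_of_ne hi with hneg | hpos
  · refine lt_of_lt_of_le ?_ (inner_le_supportFn (a := -e i) (by simp [A]) _)
    rw [inner_neg_left, h1]
    linarith
  · refine lt_of_lt_of_le ?_ (inner_le_supportFn (a := e i) (by simp [A]) _)
    rwa [h1]

end SupportFunction

/-! ### Existence of the measure. -/

section Representation

open MeasureTheory

variable {k : ℕ}

/-- A positive linear functional on `C(S, ℝ)` extending a Minkowski linear semidiversity. -/
theorem exists_positive_functional {δ : Finset (EuclideanSpace ℝ (Fin k)) → ℝ}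
    (h : IsSemidiversity δ) (hl : IsMinkowskiLinear δ) :
    ∃ g : C(Metric.sphere (0 : EuclideanSpace ℝ (Fin k)) 1, ℝ) →ₗ[ℝ] ℝ,
      (∀ A, g (sphereSupport A) = δ A.1) ∧ ∀ f, 0 ≤ f → 0 ≤ g f := by
  let D := Finsupp.linearCombination ℝ
    (fun A : {A : Finset (EuclideanSpace ℝ (Fin k)) // A.Nonempty} => δ A.1)
  have hker : (supportCombination k).ker ≤ D.ker := by
    intro f hf
    rw [LinearMap.mem_ker] at hf ⊢
    refine le_antisymm ?_ (combination_nonneg h hl hf.ge)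
    have := combination_nonneg h hl (f := -f) (by rw [map_neg, hf, neg_zero])
    rwa [map_neg, neg_nonneg] at this
  let p : C(Metric.sphere (0 : EuclideanSpace ℝ (Fin k)) 1, ℝ) →ₗ.[ℝ] ℝ :=
    ⟨(supportCombination k).range,
      (Submodule.liftQ _ D hker).comp (supportCombination k).quotKerEquivRange.symm.toLinearMap⟩
  have hp : ∀ f, p ⟨supportCombination k f, f, rfl⟩ = D f := by
    intro f
    change (Submodule.liftQ _ D hker) ((supportCombination k).quotKerEquivRange.symm ⟨_, f, rfl⟩) = _
    refine (congrArg _ (LinearMap.quotKerEquivRange_symm_apply_image _ f _)).trans ?_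
    simp
  obtain ⟨g, hg1, hg2⟩ := riesz_extension
    (PointedCone.positive ℝ C(Metric.sphere (0 : EuclideanSpace ℝ (Fin k)) 1, ℝ)) p
    (by
      rintro ⟨_, f, rfl⟩ hx
      exact (combination_nonneg h hl hx).trans_eq (hp f).symm)
    (by
      -- Cofinality: by compactness a large multiple of a strictly positive support function
      -- dominates `-y`.
      intro y
      obtain ⟨A, hA⟩ := exists_sphereSupport_pos k
      obtain ⟨c, hc⟩ : ∃ c : ℝ, ∀ x, 0 ≤ c * sphereSupport A x + y x := by
        obtain ⟨c, hc⟩ := (isCompact_univ (X := Metric.sphere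
          (0 : EuclideanSpace ℝ (Fin k)) 1)).bddAbove_image
          (f := fun x => -y x / sphereSupport A x)
          ((y.continuous.neg.div (sphereSupport A).continuous fun x => (hA x).ne').continuousOn)
        refine ⟨c, fun x => ?_⟩
        have := hc ⟨x, Set.mem_univ x, rfl⟩
        rw [div_le_iff₀ (hA x)] at this
        linarith
      refine ⟨⟨supportCombination k (Finsupp.single A c), ⟨_, rfl⟩⟩, fun x => ?_⟩
      simpa [supportCombination] using hc x)
  refine ⟨g, fun A => ?_, hg2⟩
  have h1 := hg1 ⟨supportCombination k (Finsupp.single A 1), ⟨_, rfl⟩⟩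
  replace h1 := h1.trans (hp _)
  simpa [supportCombination, D] using h1

/-- Riesz–Markov–Kakutani on a compact Hausdorff space. -/
theorem exists_measure_of_positive {X : Type*} [TopologicalSpace X] [CompactSpace X] [T2Space X]
    [MeasurableSpace X] [BorelSpace X] (g : C(X, ℝ) →ₗ[ℝ] ℝ) (hg : ∀ f, 0 ≤ f → 0 ≤ g f) :
    ∃ ν : Measure X, IsFiniteMeasure ν ∧ ∀ f : C(X, ℝ), ∫ x, f x ∂ν = g f := by
  let L : CompactlySupportedContinuousMap X ℝ →ₗ[ℝ] ℝ :=
    { toFun := fun f => g f.toContinuousMap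
      map_add' := fun f₁ f₂ => g.map_add f₁.toContinuousMap f₂.toContinuousMap
      map_smul' := fun r f => g.map_smul r f.toContinuousMap }
  let Λ := PositiveLinearMap.mk₀ L fun f hf => hg f.toContinuousMap fun x => CompactlySupportedContinuousMap.le_def.1 hf x
  exact ⟨RealRMK.rieszMeasure Λ, inferInstance, fun f =>
    RealRMK.integral_rieszMeasure Λ (CompactlySupportedContinuousMap.continuousMapEquiv f)⟩

theorem integrable_sphere {F : Type*} [NormedAddCommGroup F] [SecondCountableTopology F]
    {ν : Measure (Metric.sphere (0 : EuclideanSpace ℝ (Fin k)) 1)} [IsFiniteMeasure ν]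
    {f : Metric.sphere (0 : EuclideanSpace ℝ (Fin k)) 1 → F} (hf : Continuous f) :
    Integrable f ν :=
  hf.integrable_of_hasCompactSupport (HasCompactSupport.of_compactSpace f)

theorem integral_inner_sphere {ν : Measure (Metric.sphere (0 : EuclideanSpace ℝ (Fin k)) 1)}
    [IsFiniteMeasure ν] (a : EuclideanSpace ℝ (Fin k)) :
    ∫ x, inner ℝ a (x : EuclideanSpace ℝ (Fin k)) ∂ν
      = inner ℝ a (∫ x, (x : EuclideanSpace ℝ (Fin k)) ∂ν) :=
  integral_inner (integrable_sphere continuous_subtype_val) a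

theorem exists_isRepresentingMeasure {δ : Finset (EuclideanSpace ℝ (Fin k)) → ℝ}
    (h : IsSemidiversity δ) (hl : IsMinkowskiLinear δ) :
    ∃ ν : Measure (Metric.sphere (0 : EuclideanSpace ℝ (Fin k)) 1), IsRepresentingMeasure δ ν := by
  obtain ⟨g, hg1, hg2⟩ := exists_positive_functional h hl
  obtain ⟨ν, hν, hint⟩ := exists_measure_of_positive g hg2
  have heq : ∀ A : Finset (EuclideanSpace ℝ (Fin k)), A.Nonempty →
      δ A = ∫ x, supportFn (A : Set (EuclideanSpace ℝ (Fin k)))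
        (x : EuclideanSpace ℝ (Fin k)) ∂ν :=
    fun A hA => (hg1 ⟨A, hA⟩).symm.trans (hint _).symm
  refine ⟨ν, hν, ?_, h.eq_zero ∅ (by simp), heq⟩
  refine ext_inner_left ℝ fun a => ?_
  rw [← integral_inner_sphere, inner_zero_right]
  have h1 := heq {a} (Finset.singleton_nonempty a)
  simp only [supportFn_singleton] at h1
  rw [← h1]
  exact h.eq_zero {a} (by simp)

/-! ### The converse: representing measures give Minkowski linear semidiversities. -/

theorem integrable_supportFn {ν : Measure (Metric.sphere (0 : EuclideanSpace ℝ (Fin k)) 1)}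
    [IsFiniteMeasure ν] {A : Finset (EuclideanSpace ℝ (Fin k))} (hA : A.Nonempty) :
    Integrable (fun x : Metric.sphere (0 : EuclideanSpace ℝ (Fin k)) 1 =>
      supportFn (A : Set _) (x : EuclideanSpace ℝ (Fin k))) ν :=
  integrable_sphere ((continuous_supportFn hA).comp continuous_subtype_val)

theorem IsRepresentingMeasure.integral_inner_eq_zero {δ : Finset (EuclideanSpace ℝ (Fin k)) → ℝ}
    {ν : Measure (Metric.sphere (0 : EuclideanSpace ℝ (Fin k)) 1)}
    (h : IsRepresentingMeasure δ ν) (a : EuclideanSpace ℝ (Fin k)) :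
    ∫ x, inner ℝ a (x : EuclideanSpace ℝ (Fin k)) ∂ν = 0 := by
  have := h.finite
  rw [integral_inner_sphere, h.centroid, inner_zero_right]

theorem IsRepresentingMeasure.nonneg {δ : Finset (EuclideanSpace ℝ (Fin k)) → ℝ}
    {ν : Measure (Metric.sphere (0 : EuclideanSpace ℝ (Fin k)) 1)}
    (h : IsRepresentingMeasure δ ν) (A : Finset (EuclideanSpace ℝ (Fin k))) :
    0 ≤ δ A := by
  have := h.finite
  rcases A.eq_empty_or_nonempty with rfl | hA
  · exact h.empty.ge
  · obtain ⟨a, ha⟩ := id hA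
    -- The zero centroid lets `0` be written as the integral of `⟪a, x⟫`, which is at most `h_A`
    -- pointwise.
    rw [h.eq_integral A hA, ← h.integral_inner_eq_zero a]
    exact integral_mono (integrable_sphere (continuous_const.inner continuous_subtype_val))
      (integrable_supportFn hA) fun x => inner_le_supportFn ha _

theorem IsRepresentingMeasure.mono {δ : Finset (EuclideanSpace ℝ (Fin k)) → ℝ}
    {ν : Measure (Metric.sphere (0 : EuclideanSpace ℝ (Fin k)) 1)}
    (h : IsRepresentingMeasure δ ν) : Monotone δ := by
  have := h.finite
  intro A B hAB
  rcases A.eq_empty_or_nonempty with rfl | hA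
  · exact h.empty.trans_le (h.nonneg B)
  · rw [h.eq_integral A hA, h.eq_integral B (hA.mono hAB)]
    exact integral_mono (integrable_supportFn hA) (integrable_supportFn (hA.mono hAB))
      fun x => (supportFn_le_iff hA).2 fun a ha => inner_le_supportFn (hAB ha) _

theorem IsRepresentingMeasure.triangle {δ : Finset (EuclideanSpace ℝ (Fin k)) → ℝ}
    {ν : Measure (Metric.sphere (0 : EuclideanSpace ℝ (Fin k)) 1)}
    (h : IsRepresentingMeasure δ ν) [DecidableEq (EuclideanSpace ℝ (Fin k))]
    (A C : Finset (EuclideanSpace ℝ (Fin k))) {B : Finset (EuclideanSpace ℝ (Fin k))}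
    (hB : B.Nonempty) : δ (A ∪ C) ≤ δ (A ∪ B) + δ (B ∪ C) := by
  have := h.finite
  rcases A.eq_empty_or_nonempty with rfl | hA
  · rw [Finset.empty_union]
    exact (h.mono Finset.subset_union_right).trans (le_add_of_nonneg_left (h.nonneg _))
  rcases C.eq_empty_or_nonempty with rfl | hC
  · rw [Finset.union_empty]
    exact (h.mono Finset.subset_union_left).trans (le_add_of_nonneg_right (h.nonneg _))
  have hAC := hA.mono (Finset.subset_union_left (s₂ := C))
  have hAB := hA.mono (Finset.subset_union_left (s₂ := B))
  have hBC := hB.mono (Finset.subset_union_left (s₂ := C))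
  -- A stronger inequality, from `max a c + b ≤ max a b + max b c` pointwise.
  have key : δ (A ∪ C) + δ B ≤ δ (A ∪ B) + δ (B ∪ C) := by
    rw [h.eq_integral _ hAC, h.eq_integral _ hAB, h.eq_integral _ hBC, h.eq_integral _ hB,
      ← integral_add (integrable_supportFn hAC) (integrable_supportFn hB),
      ← integral_add (integrable_supportFn hAB) (integrable_supportFn hBC)]
    refine integral_mono ((integrable_supportFn hAC).add (integrable_supportFn hB))
      ((integrable_supportFn hAB).add (integrable_supportFn hBC)) fun x => ?_
    simp only [supportFn_union hA hC, supportFn_union hA hB, supportFn_union hB hC]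
    rw [max_add]
    exact max_le (add_le_add (le_max_left _ _) (le_max_left _ _))
      ((add_comm _ _).trans_le (add_le_add (le_max_right _ _) (le_max_right _ _)))
  linarith [h.nonneg B]

theorem IsRepresentingMeasure.isSemidiversity {δ : Finset (EuclideanSpace ℝ (Fin k)) → ℝ}
    {ν : Measure (Metric.sphere (0 : EuclideanSpace ℝ (Fin k)) 1)}
    (h : IsRepresentingMeasure δ ν) : IsSemidiversity δ := by
  refine ⟨h.nonneg, fun A hA => ?_, fun A B C hB => by convert h.triangle A C hB⟩
  rcases Finset.card_le_one_iff_subset_singleton.1 hA with ⟨a, ha⟩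
  refine le_antisymm ((h.mono ha).trans_eq ?_) (h.nonneg A)
  rw [h.eq_integral _ (Finset.singleton_nonempty a), ← h.integral_inner_eq_zero a]
  simp only [supportFn_singleton]

theorem IsRepresentingMeasure.smul {δ : Finset (EuclideanSpace ℝ (Fin k)) → ℝ}
    {ν : Measure (Metric.sphere (0 : EuclideanSpace ℝ (Fin k)) 1)}
    (h : IsRepresentingMeasure δ ν) [DecidableEq (EuclideanSpace ℝ (Fin k))]
    {r : ℝ} (hr : 0 ≤ r) {A : Finset (EuclideanSpace ℝ (Fin k))} (hA : A.Nonempty) :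
    δ (r • A) = r * δ A := by
  rw [h.eq_integral _ hA.smul_finset, h.eq_integral A hA, ← integral_const_mul]
  simp only [supportFn_smul hA hr]

theorem IsRepresentingMeasure.add {δ : Finset (EuclideanSpace ℝ (Fin k)) → ℝ}
    {ν : Measure (Metric.sphere (0 : EuclideanSpace ℝ (Fin k)) 1)}
    (h : IsRepresentingMeasure δ ν) [DecidableEq (EuclideanSpace ℝ (Fin k))]
    {A B : Finset (EuclideanSpace ℝ (Fin k))} (hA : A.Nonempty) (hB : B.Nonempty) :
    δ (A + B) = δ A + δ B := by
  have := h.finite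
  rw [h.eq_integral _ (hA.add hB), h.eq_integral A hA, h.eq_integral B hB,
    ← integral_add (integrable_supportFn hA) (integrable_supportFn hB)]
  simp only [supportFn_add hA hB]

theorem IsRepresentingMeasure.isMinkowskiLinear {δ : Finset (EuclideanSpace ℝ (Fin k)) → ℝ}
    {ν : Measure (Metric.sphere (0 : EuclideanSpace ℝ (Fin k)) 1)}
    (h : IsRepresentingMeasure δ ν) : IsMinkowskiLinear δ :=
  ⟨fun _ _ hr hA => by convert h.smul hr hA; rfl, fun _ _ hA hB => by convert h.add hA hB⟩

/-! ### Density of the span and uniqueness. -/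

theorem exists_sub_of_mem_range {f : C(Metric.sphere (0 : EuclideanSpace ℝ (Fin k)) 1, ℝ)}
    (hf : f ∈ (supportCombination k).range) :
    ∃ A B, f = sphereSupport A - sphereSupport B := by
  obtain ⟨f, rfl⟩ := hf
  -- Only the identity of functions is wanted, so the zero function serves as `δ`.
  have hl : IsMinkowskiLinear (fun _ : Finset (EuclideanSpace ℝ (Fin k)) => (0 : ℝ)) :=
    ⟨by simp, by simp⟩
  obtain ⟨A, B, h, -⟩ := exists_sub_of_combination hl f
  exact ⟨A, B, h⟩

theorem sphereSupport_mem_range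
    (A : {A : Finset (EuclideanSpace ℝ (Fin k)) // A.Nonempty}) :
    sphereSupport A ∈ (supportCombination k).range :=
  ⟨Finsupp.single A 1, by simp [supportCombination]⟩

theorem sup_mem_range_supportCombination
    {f g : C(Metric.sphere (0 : EuclideanSpace ℝ (Fin k)) 1, ℝ)}
    (hf : f ∈ (supportCombination k).range) (hg : g ∈ (supportCombination k).range) :
    f ⊔ g ∈ (supportCombination k).range := by
  classical
  obtain ⟨A, B, rfl⟩ := exists_sub_of_mem_range hf
  obtain ⟨C, D, rfl⟩ := exists_sub_of_mem_range hg
  have e : (sphereSupport A - sphereSupport B) ⊔ (sphereSupport C - sphereSupport D)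
      = ((sphereSupport A + sphereSupport D) ⊔ (sphereSupport C + sphereSupport B))
        - (sphereSupport B + sphereSupport D) := by
    ext x
    simp only [ContinuousMap.sup_apply, ContinuousMap.sub_apply, ContinuousMap.add_apply]
    rw [← max_sub_sub_right]
    congr 1 <;> ring
  rw [e, ← sphereSupport_add, ← sphereSupport_add, ← sphereSupport_union, ← sphereSupport_add]
  exact sub_mem (sphereSupport_mem_range _) (sphereSupport_mem_range _)

/-- A support function on the sphere that is positive at `x` and vanishes at `y`. -/
theorem exists_sphereSupport_pos_eq_zero
    {x y : Metric.sphere (0 : EuclideanSpace ℝ (Fin k)) 1} (hxy : x ≠ y) :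
    ∃ A, 0 < sphereSupport A x ∧ sphereSupport A y = 0 := by
  classical
  have hx : ‖(x : EuclideanSpace ℝ (Fin k))‖ = 1 := norm_eq_of_mem_sphere x
  have hy : ‖(y : EuclideanSpace ℝ (Fin k))‖ = 1 := norm_eq_of_mem_sphere y
  have hlt : inner ℝ (x : EuclideanSpace ℝ (Fin k)) (y : EuclideanSpace ℝ (Fin k)) < 1 :=
    (inner_lt_one_iff_real_of_norm_eq_one hx hy).2 fun h => hxy (Subtype.ext h)
  -- The support function is the positive part of `⟪x - y, ·⟫`, whose values at `x` and `y` are `±(1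
  -- - ⟪x, y⟫)`.
  refine ⟨⟨{0, (x : EuclideanSpace ℝ (Fin k)) - (y : EuclideanSpace ℝ (Fin k))}, by simp⟩, ?_, ?_⟩
  · refine lt_of_lt_of_le ?_ (inner_le_supportFn (a := (x : EuclideanSpace ℝ (Fin k)) - (y : EuclideanSpace ℝ (Fin k)))
      (by simp) _)
    rw [inner_sub_left, real_inner_self_eq_norm_sq, hx, real_inner_comm]
    linarith
  · refine le_antisymm ((supportFn_le_iff (by simp)).2 ?_)
      (le_of_eq_of_le (inner_zero_left _).symm
        (inner_le_supportFn (a := (0 : EuclideanSpace ℝ (Fin k))) (by simp) _))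
    intro a ha
    rcases Finset.mem_insert.1 ha with rfl | ha
    · simp
    · rw [Finset.mem_singleton.1 ha, inner_sub_left, real_inner_self_eq_norm_sq, hy]
      linarith

/-- The lattice form of Stone–Weierstrass applies: the span is closed under `⊔` and `⊓` and attains
any prescribed values at two points. -/
theorem dense_range_supportCombination (k : ℕ) :
    closure ((supportCombination k).range :
      Set C(Metric.sphere (0 : EuclideanSpace ℝ (Fin k)) 1, ℝ)) = ⊤ := by
  refine ContinuousMap.sublattice_closure_eq_top _ ⟨0, zero_mem _⟩ (fun f hf g hg => ?_)
    (fun f hf g hg => sup_mem_range_supportCombination hf hg) fun v x y => ?_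
  · have : f ⊓ g = -(-f ⊔ -g) := by
      ext z
      simp [max_neg_neg]
    rw [this]
    exact neg_mem (sup_mem_range_supportCombination (neg_mem hf) (neg_mem hg))
  · by_cases hxy : x = y
    · subst hxy
      obtain ⟨A, hA⟩ := exists_sphereSupport_pos k
      refine ⟨(v x / sphereSupport A x) • sphereSupport A,
        Submodule.smul_mem _ _ (sphereSupport_mem_range A), ?_, ?_⟩ <;>
      simp [(hA x).ne']
    · obtain ⟨A, hA1, hA2⟩ := exists_sphereSupport_pos_eq_zero hxy
      obtain ⟨B, hB1, hB2⟩ := exists_sphereSupport_pos_eq_zero (Ne.symm hxy)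
      refine ⟨(v x / sphereSupport A x) • sphereSupport A
          + (v y / sphereSupport B y) • sphereSupport B,
        add_mem (Submodule.smul_mem _ _ (sphereSupport_mem_range A))
          (Submodule.smul_mem _ _ (sphereSupport_mem_range B)), ?_, ?_⟩
      · simp [hA1.ne', hB2]
      · simp [hB1.ne', hA2]

theorem ContinuousMap.continuous_integral {X : Type*} [TopologicalSpace X] [CompactSpace X]
    [MeasurableSpace X] [BorelSpace X] (ν : Measure X) [IsFiniteMeasure ν] :
    Continuous fun f : C(X, ℝ) => ∫ x, f x ∂ν := by
  refine continuous_iff_continuousAt.2 fun f => ?_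
  refine continuousAt_of_dominated (bound := fun _ => ‖f‖ + 1)
    (Filter.Eventually.of_forall fun g => g.continuous.aestronglyMeasurable) ?_
    (integrable_const _) (Filter.Eventually.of_forall fun x =>
      (continuous_eval_const x).continuousAt)
  filter_upwards [continuous_norm.continuousAt.eventually_lt continuousAt_const
    (lt_add_one ‖f‖)] with g hg
  exact Filter.Eventually.of_forall fun x => (g.norm_coe_le_norm x).trans hg.le

theorem IsRepresentingMeasure.unique {δ : Finset (EuclideanSpace ℝ (Fin k)) → ℝ}
    {ν ν' : Measure (Metric.sphere (0 : EuclideanSpace ℝ (Fin k)) 1)}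
    (h : IsRepresentingMeasure δ ν) (h' : IsRepresentingMeasure δ ν') : ν = ν' := by
  have := h.finite
  have := h'.finite
  have hcl : IsClosed {f : C(Metric.sphere (0 : EuclideanSpace ℝ (Fin k)) 1, ℝ) |
      ∫ x, f x ∂ν = ∫ x, f x ∂ν'} :=
    isClosed_eq (ContinuousMap.continuous_integral ν) (ContinuousMap.continuous_integral ν')
  have hsub : ((supportCombination k).range :
      Set C(Metric.sphere (0 : EuclideanSpace ℝ (Fin k)) 1, ℝ)) ⊆
      {f | ∫ x, f x ∂ν = ∫ x, f x ∂ν'} := by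
    intro f hf
    obtain ⟨A, B, rfl⟩ := exists_sub_of_mem_range hf
    have e : ∀ C : {A : Finset (EuclideanSpace ℝ (Fin k)) // A.Nonempty},
        ∫ x, sphereSupport C x ∂ν = ∫ x, sphereSupport C x ∂ν' := fun C =>
      (h.eq_integral C.1 C.2).symm.trans (h'.eq_integral C.1 C.2)
    have hi : ∀ (μ : Measure (Metric.sphere (0 : EuclideanSpace ℝ (Fin k)) 1))
        [IsFiniteMeasure μ] (C : {A : Finset (EuclideanSpace ℝ (Fin k)) // A.Nonempty}),
        Integrable (fun x => sphereSupport C x) μ := fun μ _ C =>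
      integrable_sphere (sphereSupport C).continuous
    simp only [Set.mem_ofPred_eq, ContinuousMap.sub_apply]
    rw [integral_sub (hi ν A) (hi ν B), integral_sub (hi ν' A) (hi ν' B), e A, e B]
  have hall := closure_minimal hsub hcl
  rw [dense_range_supportCombination] at hall
  exact ext_of_forall_integral_eq_of_IsFiniteMeasure fun f => hall (a := f.toContinuousMap) trivial

end Representation

theorem mainTheorem1 (k : ℕ) (δ : Finset (EuclideanSpace ℝ (Fin k)) → ℝ) :
    ((IsSemidiversity δ ∧ IsMinkowskiLinear δ) ↔
      ∃ ν : MeasureTheory.Measure (Metric.sphere (0 : EuclideanSpace ℝ (Fin k)) 1),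
        IsRepresentingMeasure δ ν) ∧
    (∀ ν ν' : MeasureTheory.Measure (Metric.sphere (0 : EuclideanSpace ℝ (Fin k)) 1),
      IsRepresentingMeasure δ ν → IsRepresentingMeasure δ ν' → ν = ν') :=
  ⟨⟨fun h => exists_isRepresentingMeasure h.1 h.2,
    fun ⟨_, h⟩ => ⟨h.isSemidiversity, h.isMinkowskiLinear⟩⟩, fun _ _ h h' => h.unique h'⟩
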